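/- Conventions. Let $\varPi=\varPi_n$ be the set of $n\times n$ permutation matrices and $\mathcal D=\mathcal D_n$ the set of $n\times n$ doubly stochastic matrices (nonnegative real matrices whose row and column sums all equal $1$); let $\langle C,D\rangle=\operatorname{trace}(C^{T}D)$ and let $\|\cdot\|_F$ be the Frobenius norm. For $\rho\in[0,1]$ and a symmetric matrix $\Lambda\in[0,1]^{n\times n}$ with zero diagonal, random symmetric $0/1$ matrices $A,B$ with zero diagonal are the adjacency matrices of $\rho$-correlated Bernoulli$(\Lambda)$ random graphs if, for each pair $\{i,j\}$ with $i\ne j$, $A_{i,j}$ and $B_{i,j}$ are Bernoulli$(\Lambda_{i,j})$ random variables with Pearson correlation coefficient $\rho$, and the random pairs $(A_{i,j},B_{i,j})$, $i<j$, are mutually independent. **Theorem.** Fix $\rho\in[0,1]$ and $\alpha\in(0,1/2)$. For each $n=1,2,3,\dots$ let $\Lambda^{(n)}\in[0,1]^{n\times n}$ be symmetric with zero diagonal and $\Lambda^{(n)}_{i,j}\in[\alpha,1-\alpha]$ for all $i\neq j$, let $A_n,B_n$ be the adjacency matrices of $\rho$-correlated Bernoulli$(\Lambda^{(n)})$ random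 graphs, all defined on one probability space (with arbitrary joint dependence across different $n$), let $P^*_n\in\varPi_n$ be a (deterministic) permutation matrix, and put $A'_n=P^*_nA_n(P^*_n)^{T}$. (a) If $(1-\alpha)(1-\rho)<1/2$, then almost surely, for all but finitely many $n$, $$\operatorname*{arg\,min}_{D\in\mathcal D_n}\,-\langle A'_nD,\,DB_n\rangle \;=\; \operatorname*{arg\,min}_{P\in\varPi_n}\,\|A'_n-PB_nP^{T}\|_F \;=\;\{P^*_n\}.$$ (b) If $\rho<1$, then almost surely, for all but finitely many $n$, $$P^*_n\notin\operatorname*{arg\,min}_{D\in\mathcal D_n}\,\|A'_nD-DB_n\|_F.$$ -/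

import Mathlib

open MeasureTheory ProbabilityTheory Filter
open scoped Matrix

noncomputable section

/-- The set `Π` of `n × n` permutation matrices. -/
def permMatrices (n : ℕ) : Set (Matrix (Fin n) (Fin n) ℝ) :=
  {M | ∃ σ : Equiv.Perm (Fin n), σ.permMatrix ℝ = M}

/-- The set `𝒟` of `n × n` doubly stochastic matrices: nonnegative real matrices all of whose row
and column sums are `1`. -/
def doublyStochasticMatrices (n : ℕ) : Set (Matrix (Fin n) (Fin n) ℝ) :=
  (doublyStochastic ℝ (Fin n) : Set (Matrix (Fin n) (Fin n) ℝ))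

/-- The Euclidean inner product `⟨C, D⟩ = trace (Cᵀ D)` of real matrices. -/
def matrixInner {n : ℕ} (C D : Matrix (Fin n) (Fin n) ℝ) : ℝ :=
  (Cᵀ * D).trace

section Frobenius

attribute [local instance] Matrix.frobeniusNormedAddCommGroup

/-- The Frobenius norm of a real square matrix. -/
def frobeniusNorm {n : ℕ} (M : Matrix (Fin n) (Fin n) ℝ) : ℝ := ‖M‖

end Frobenius

/-- The set of global minimizers of `f` over `s`. -/
def argminSet {X : Type*} (f : X → ℝ) (s : Set X) : Set X :=
  {x | x ∈ s ∧ IsMinOn f s x}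

/-- `A` and `B` are the adjacency matrices of `ρ`-correlated Bernoulli(`Λ`) random (simple) graphs
on `n` vertices: for every pair `i ≠ j` the entries `A i j`, `B i j` are Bernoulli(`Λ i j`) with
Pearson correlation coefficient `ρ`, and apart from this the entries are collectively independent,
i.e. the random pairs `(A i j, B i j)`, one for each unordered pair `{i, j}` of distinct vertices,
are independent. -/
structure IsCorrelatedBernoulli {Ω : Type*} [MeasurableSpace Ω] (μ : Measure Ω) {n : ℕ} (ρ : ℝ)
    (Λ : Matrix (Fin n) (Fin n) ℝ) (A B : Ω → Matrix (Fin n) (Fin n) ℝ) : Prop where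
  /-- The values are adjacency matrices: symmetric, zero diagonal, entries in `{0, 1}`. -/
  isAdjMatrix_left : ∀ ω, (A ω).IsAdjMatrix
  isAdjMatrix_right : ∀ ω, (B ω).IsAdjMatrix
  measurable_left : ∀ i j, Measurable fun ω => A ω i j
  measurable_right : ∀ i j, Measurable fun ω => B ω i j
  /-- The marginals are Bernoulli. -/
  bernoulli_left : ∀ i j, i ≠ j → μ.real {ω | A ω i j = 1} = Λ i j
  bernoulli_right : ∀ i j, i ≠ j → μ.real {ω | B ω i j = 1} = Λ i j
  /-- The Pearson correlation coefficient of `A i j` and `B i j` is `ρ`, written without division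
  so that nothing is required for a degenerate entry, where the coefficient is undefined. -/
  correlation : ∀ i j, i ≠ j →
    cov[fun ω => A ω i j, fun ω => B ω i j; μ] =
      ρ * (√(Var[fun ω => A ω i j; μ]) * √(Var[fun ω => B ω i j; μ]))
  /-- Independence over the unordered pairs `{i, j}`, listed with `i < j`. -/
  indep : iIndepFun
    (fun (e : {p : Fin n × Fin n // p.1 < p.2}) ω => (A ω e.1.1 e.1.2, B ω e.1.1 e.1.2)) μ

end

/-! For (a), substituting `D = P* E` turns `⟨A'D, DB⟩` into `⟨AE, EB⟩`. By Birkhoff's theorem `E` is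
a convex combination of permutation matrices, so this is a weighted average of the sums `∑ A i j * B
(τ i) (σ j)`. Both equalities therefore follow once every pair `(σ, τ)` other than the identity
gives strictly less than `∑ A i j * B i j`. The mean gap is at least `ρ α (1 - α)` per ordered pair
whose edge is moved: correlation supplies this amount, and the means contribute a nonnegative
rearrangement sum. McDiarmid's inequality over the independent edges bounds the failure probability
by an exponential in the number of moved pairs, which is at least `n / 4` times the number of points
moved by `σ` and by `τ`. A union bound weighted by supports is summable, and Borel–Cantelli applies.

For (b), moving from `P*` towards the barycentre strictly decreases the norm whenever `A ≠ B`: with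
`C = A - B`, the first-order term is negative by Cauchy–Schwarz on the `n - 1` off-diagonal entries
of each row of `C`. The event `A = B` has geometrically small probability, so Borel–Cantelli
finishes again. -/

/-! ### Concentration for functions of independent variables -/

/-- **Hoeffding's lemma**, for a random variable whose oscillation is at most `c`. -/
theorem integral_exp_mul_sub_integral_le_of_oscillation {E : Type*} [MeasurableSpace E]
    (ν : Measure E) [IsProbabilityMeasure ν] {X : E → ℝ} (hX : Measurable X) {c : ℝ}
    (hc : ∀ x y, |X x - X y| ≤ c) (t : ℝ) :
    ∫ x, Real.exp (t * (X x - ∫ y, X y ∂ν)) ∂ν ≤ Real.exp (t ^ 2 * c ^ 2 / 8) := by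
  obtain ⟨x₀⟩ : Nonempty E := nonempty_of_isProbabilityMeasure ν
  have hbdd : BddBelow (Set.range X) := by
    refine ⟨X x₀ - c, ?_⟩
    rintro _ ⟨y, rfl⟩
    linarith [(abs_le.1 (hc x₀ y)).2]
  have hmem : ∀ᵐ x ∂ν, X x ∈ Set.Icc (⨅ y, X y) ((⨅ y, X y) + c) := by
    refine ae_of_all _ fun x => ⟨ciInf_le hbdd x, ?_⟩
    have : X x - c ≤ ⨅ y, X y := by
      have : Nonempty E := ⟨x₀⟩
      exact le_ciInf fun y => by linarith [(abs_le.1 (hc x y)).2]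
    linarith
  have h := (hasSubgaussianMGF_of_mem_Icc hX.aemeasurable hmem).mgf_le t
  simp only [mgf] at h
  refine h.trans (le_of_eq ?_)
  congr 1
  simp only [add_sub_cancel_left, NNReal.coe_pow, NNReal.coe_div, coe_nnnorm, NNReal.coe_ofNat,
    div_pow, Real.norm_eq_abs, sq_abs]
  ring

theorem integrable_of_measurable_of_abs_le {E : Type*} [MeasurableSpace E] {ν : Measure E}
    [IsFiniteMeasure ν] {f : E → ℝ} (hf : Measurable f) {K : ℝ} (hK : ∀ x, |f x| ≤ K) :
    Integrable f ν :=
  Integrable.of_bound hf.aestronglyMeasurable K (ae_of_all _ hK)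

theorem abs_integral_le_of_abs_le {E : Type*} [MeasurableSpace E] {ν : Measure E}
    [IsProbabilityMeasure ν] {f : E → ℝ} {K : ℝ} (hK : ∀ x, |f x| ≤ K) :
    |∫ x, f x ∂ν| ≤ K := by
  simpa using norm_integral_le_of_norm_le_const (μ := ν) (f := f) (C := K) (ae_of_all _ hK)

/-- Induction step for McDiarmid: `f` minus its mean splits as `(f - g) + (g - mean)` with `g` the
section mean. The first part is controlled by `hC`; the second by Hoeffding's lemma, as averaging
preserves oscillation at most `c`. -/
theorem integral_exp_mul_sub_integral_prod_le {E F : Type*} [MeasurableSpace E]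
    [MeasurableSpace F] (μ : Measure E) (ν : Measure F) [IsProbabilityMeasure μ]
    [IsProbabilityMeasure ν] {f : E × F → ℝ} (hf : Measurable f) {K : ℝ} (hK : ∀ x, |f x| ≤ K)
    {c C t : ℝ} (hc : ∀ x x' y, |f (x, y) - f (x', y)| ≤ c)
    (hC : ∀ x, ∫ y, Real.exp (t * (f (x, y) - ∫ z, f (x, z) ∂ν)) ∂ν ≤ C) :
    ∫ p, Real.exp (t * (f p - ∫ q, f q ∂μ.prod ν)) ∂μ.prod ν ≤
      C * Real.exp (t ^ 2 * c ^ 2 / 8) := by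
  have hfi : Integrable f (μ.prod ν) := integrable_of_measurable_of_abs_le hf hK
  have hsec : ∀ x, Integrable (fun y => f (x, y)) ν := fun x =>
    integrable_of_measurable_of_abs_le (hf.comp measurable_prodMk_left) fun y => hK (x, y)
  set g : E → ℝ := fun x => ∫ y, f (x, y) ∂ν with hg
  have hgm : Measurable g :=
    (hf.stronglyMeasurable.integral_prod_right' (ν := ν)).measurable
  have hgK : ∀ x, |g x| ≤ K := fun x => abs_integral_le_of_abs_le fun y => hK (x, y)
  have hgc : ∀ x x', |g x - g x'| ≤ c := fun x x' => by
    rw [hg]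
    simp only
    rw [← integral_sub (hsec x) (hsec x')]
    exact abs_integral_le_of_abs_le fun y => hc x x' y
  have hint : ∫ q, f q ∂μ.prod ν = ∫ x, g x ∂μ := integral_prod f hfi
  set m := ∫ x, g x ∂μ with hm
  have hmK : |m| ≤ K := abs_integral_le_of_abs_le hgK
  have habs : ∀ {a b : ℝ}, |a| ≤ K → |b| ≤ K →
      |Real.exp (t * (a - b))| ≤ Real.exp (|t| * (2 * K)) := by
    intro a b ha hb
    rw [abs_of_pos (Real.exp_pos _)]
    refine Real.exp_le_exp.2 ((le_abs_self _).trans ?_)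
    rw [abs_mul]
    refine mul_le_mul_of_nonneg_left ?_ (abs_nonneg _)
    exact (abs_sub _ _).trans (by linarith)
  rw [hint]
  have hexpi : Integrable (fun p => Real.exp (t * (f p - m))) (μ.prod ν) :=
    integrable_of_measurable_of_abs_le (by fun_prop) fun p => habs (hK p) hmK
  rw [integral_prod _ hexpi]
  have hfac : ∀ x, ∫ y, Real.exp (t * (f (x, y) - m)) ∂ν =
      Real.exp (t * (g x - m)) * ∫ y, Real.exp (t * (f (x, y) - g x)) ∂ν := fun x => by
    rw [← integral_const_mul]
    congr 1
    funext y
    rw [← Real.exp_add]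
    congr 1
    ring
  calc ∫ x, ∫ y, Real.exp (t * (f (x, y) - m)) ∂ν ∂μ
      ≤ ∫ x, Real.exp (t * (g x - m)) * C ∂μ := by
        refine integral_mono hexpi.integral_prod_left ?_ fun x => ?_
        · exact (integrable_of_measurable_of_abs_le (by fun_prop)
            fun x => habs (hgK x) hmK).mul_const C
        · simp only
          rw [hfac x]
          exact mul_le_mul_of_nonneg_left (hC x) (Real.exp_pos _).le
    _ = C * ∫ x, Real.exp (t * (g x - m)) ∂μ := by
        rw [integral_mul_const, mul_comm]
    _ ≤ C * Real.exp (t ^ 2 * c ^ 2 / 8) := by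
        refine mul_le_mul_of_nonneg_left
          (integral_exp_mul_sub_integral_le_of_oscillation μ hgm hgc t) ?_
        obtain ⟨x₀⟩ : Nonempty E := nonempty_of_isProbabilityMeasure μ
        exact (integral_nonneg fun y => (Real.exp_pos _).le).trans (hC x₀)

/-- **McDiarmid's inequality** in moment generating function form, for a product measure. -/
theorem integral_exp_mul_sub_integral_pi_fin_le {E : Type*} [MeasurableSpace E] (t : ℝ) :
    ∀ (m : ℕ) (ν : Fin m → Measure E) [∀ i, IsProbabilityMeasure (ν i)] (f : (Fin m → E) → ℝ)
      (_ : Measurable f) (K : ℝ) (_ : ∀ x, |f x| ≤ K) (c : Fin m → ℝ)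
      (_ : ∀ x i y, |f (Function.update x i y) - f x| ≤ c i),
      ∫ x, Real.exp (t * (f x - ∫ y, f y ∂Measure.pi ν)) ∂Measure.pi ν ≤
        Real.exp (t ^ 2 * (∑ i, c i ^ 2) / 8)
  | 0, ν, _, f, _, K, _, c, _ => by
    have h : ∀ x, f x = f Fin.elim0 := fun x => congrArg f (Subsingleton.elim _ _)
    simp [h]
  | m + 1, ν, _, f, hf, K, hK, c, hc => by
    have hmp := (measurePreserving_piFinSuccAbove ν 0).symm
    set e := (MeasurableEquiv.piFinSuccAbove (fun _ : Fin (m + 1) => E) 0).symm with he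
    have hcons : ∀ x y, e (x, y) = Fin.cons x y := fun x y => by
      simp [he, MeasurableEquiv.piFinSuccAbove, Fin.insertNthEquiv]
    have hone : ∀ (h : (Fin (m + 1) → E) → ℝ), ∫ x, h x ∂Measure.pi ν =
        ∫ p, h (e p) ∂(ν 0).prod (Measure.pi fun j => ν (Fin.succAbove 0 j)) := fun h =>
      (hmp.integral_comp e.measurableEmbedding h).symm
    rw [hone, hone f]
    have hsum : Real.exp (t ^ 2 * (∑ i, c i ^ 2) / 8) =
        Real.exp (t ^ 2 * (∑ i : Fin m, c i.succ ^ 2) / 8) * Real.exp (t ^ 2 * c 0 ^ 2 / 8) := by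
      rw [← Real.exp_add, Fin.sum_univ_succ]
      congr 1
      ring
    rw [hsum]
    refine integral_exp_mul_sub_integral_prod_le _ _ (f := fun p => f (e p))
      (hf.comp e.measurable) (fun p => hK _) ?_ ?_
    · intro x x' y
      have h := hc (Fin.cons x' y) 0 x
      rw [Fin.update_cons_zero] at h
      simpa only [hcons] using h
    · intro x
      simp only [hcons]
      refine integral_exp_mul_sub_integral_pi_fin_le t m _ (fun y => f (Fin.cons x y)) ?_ K
        (fun y => hK _) (fun i => c i.succ) ?_
      · simp only [← hcons]
        exact hf.comp (e.measurable.comp measurable_prodMk_left)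
      · intro y i z
        have h := hc (Fin.cons x y) i.succ z
        rwa [← Fin.cons_update] at h

/-- **McDiarmid's inequality**, lower tail: a function with bounded differences `c` of independent
random variables is at most `0` with probability exponentially small in its mean squared. -/
theorem measureReal_nonpos_le_of_bounded_differences {Ω E ι : Type*} [MeasurableSpace Ω]
    [MeasurableSpace E] [Fintype ι] [DecidableEq ι] {μ : Measure Ω} [IsProbabilityMeasure μ]
    {X : ι → Ω → E} (hX : ∀ i, Measurable (X i)) (hind : iIndepFun X μ)
    {f : (ι → E) → ℝ} (hf : Measurable f) {K : ℝ} (hK : ∀ x, |f x| ≤ K) {c : ι → ℝ}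
    (hc : ∀ x i y, |f (Function.update x i y) - f x| ≤ c i) {s V : ℝ} (hs : 0 ≤ s) (hV : 0 < V)
    (hsV : ∑ i, c i ^ 2 ≤ V) (hmean : s ≤ ∫ ω, f (fun i => X i ω) ∂μ) :
    μ.real {ω | f (fun i => X i ω) ≤ 0} ≤ Real.exp (-(2 * s ^ 2 / V)) := by
  set e := (Fintype.equivFin ι).symm
  set X' : Fin (Fintype.card ι) → Ω → E := fun i => X (e i) with hX'
  have hX'm : ∀ i, Measurable (X' i) := fun i => hX _
  have hind' : iIndepFun X' μ := hind.precomp e.injective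
  have hmap := (iIndepFun_iff_map_fun_eq_pi_map fun i => (hX'm i).aemeasurable).1 hind'
  have : ∀ i, IsProbabilityMeasure (μ.map (X' i)) := fun i =>
    Measure.isProbabilityMeasure_map (hX'm i).aemeasurable
  set f' : (Fin (Fintype.card ι) → E) → ℝ := fun y => f fun i => y (e.symm i) with hf'
  have hf'm : Measurable f' := hf.comp (measurable_pi_lambda _ fun i => measurable_pi_apply _)
  have hvec : Measurable fun ω i => X' i ω := measurable_pi_lambda _ hX'm
  have hcomp : ∀ ω, f' (fun i => X' i ω) = f fun i => X i ω := fun ω => by simp [hf', hX']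
  set M := ∫ ω, f (fun i => X i ω) ∂μ with hM
  have key : ∀ t, ∫ ω, Real.exp (t * (f (fun i => X i ω) - M)) ∂μ ≤
      Real.exp (t ^ 2 * (∑ i, c i ^ 2) / 8) := by
    intro t
    have h := integral_exp_mul_sub_integral_pi_fin_le t _ (fun i => μ.map (X' i)) f' hf'm K
      (fun x => hK _) (fun i => c (e i)) (by
        intro x i y
        have h := hc (fun j => x (e.symm j)) (e i) y
        have h2 : (fun j => Function.update x i y (e.symm j)) =
            Function.update (fun j => x (e.symm j)) (e i) y := by
          funext j
          by_cases hj : j = e i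
          · subst hj; simp
          · rw [Function.update_of_ne hj, Function.update_of_ne]
            rintro rfl
            simp at hj
        simp only [hf', h2]
        exact h)
    rw [← hmap, integral_map hvec.aemeasurable hf'm.aestronglyMeasurable,
      integral_map hvec.aemeasurable (by fun_prop)] at h
    simp only [hcomp] at h
    rwa [Equiv.sum_comp e fun i => c i ^ 2] at h
  have hfX : Measurable fun ω => f fun i => X i ω := hf.comp (measurable_pi_lambda _ hX)
  -- This `t` minimizes the Chernoff exponent `-t s + t² V / 8`.
  set t : ℝ := 4 * s / V with ht
  have ht0 : 0 ≤ t := by positivity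
  have hint : Integrable (fun ω => Real.exp (-t * (f (fun i => X i ω) - M))) μ := by
    refine integrable_of_measurable_of_abs_le (K := Real.exp (|t| * (2 * K))) (by fun_prop) ?_
    intro ω
    rw [abs_of_pos (Real.exp_pos _)]
    refine Real.exp_le_exp.2 ((le_abs_self _).trans ?_)
    rw [abs_mul, abs_neg]
    refine mul_le_mul_of_nonneg_left ?_ (abs_nonneg _)
    have hMK : |M| ≤ K := abs_integral_le_of_abs_le fun ω => hK _
    exact (abs_sub _ _).trans (by linarith [hK fun i => X i ω])
  have hch := measure_le_le_exp_mul_mgf (μ := μ) (X := fun ω => f (fun i => X i ω) - M) (-s)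
    (neg_nonpos.2 ht0) hint
  have hsub : μ.real {ω | f (fun i => X i ω) ≤ 0} ≤
      μ.real {ω | f (fun i => X i ω) - M ≤ -s} := by
    refine measureReal_mono fun ω hω => ?_
    simp only [Set.mem_ofPred_eq] at hω ⊢
    linarith
  refine hsub.trans (hch.trans ?_)
  have hk := key (-t)
  refine (mul_le_mul_of_nonneg_left hk (Real.exp_pos _).le).trans ?_
  rw [← Real.exp_add]
  refine Real.exp_le_exp.2 ?_
  have h1 : (-t) ^ 2 * (∑ i, c i ^ 2) / 8 ≤ (-t) ^ 2 * V / 8 := by gcongr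
  have h2 : -(-t) * -s + (-t) ^ 2 * V / 8 = -(2 * s ^ 2 / V) := by
    rw [ht]
    field_simp
    ring
  linarith

/-! ### First and second moments of the entries -/

namespace IsCorrelatedBernoulli

variable {Ω : Type*} [MeasurableSpace Ω] {μ : Measure Ω} {n : ℕ} {ρ : ℝ}
  {Λ : Matrix (Fin n) (Fin n) ℝ} {A B : Ω → Matrix (Fin n) (Fin n) ℝ}

theorem swap (h : IsCorrelatedBernoulli μ ρ Λ A B) : IsCorrelatedBernoulli μ ρ Λ B A where
  isAdjMatrix_left := h.isAdjMatrix_right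
  isAdjMatrix_right := h.isAdjMatrix_left
  measurable_left := h.measurable_right
  measurable_right := h.measurable_left
  bernoulli_left := h.bernoulli_right
  bernoulli_right := h.bernoulli_left
  correlation i j hij := by
    rw [covariance_comm, h.correlation i j hij]
    ring
  indep := h.indep.comp (fun _ => Prod.swap) fun _ => measurable_swap

theorem abs_left_le_one (h : IsCorrelatedBernoulli μ ρ Λ A B) (ω : Ω) (i j : Fin n) :
    |A ω i j| ≤ 1 := by
  rcases (h.isAdjMatrix_left ω).zero_or_one i j with h | h <;> simp [h]

theorem left_mul_self (h : IsCorrelatedBernoulli μ ρ Λ A B) (ω : Ω) (i j : Fin n) :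
    A ω i j * A ω i j = A ω i j := by
  rcases (h.isAdjMatrix_left ω).zero_or_one i j with h | h <;> simp [h]

theorem integral_left (h : IsCorrelatedBernoulli μ ρ Λ A B) {i j : Fin n} (hij : i ≠ j) :
    ∫ ω, A ω i j ∂μ = Λ i j := by
  have hm : MeasurableSet {ω | A ω i j = 1} :=
    h.measurable_left i j (measurableSet_singleton (1 : ℝ))
  rw [← h.bernoulli_left i j hij, ← integral_indicator_one hm]
  congr 1
  funext ω
  rcases (h.isAdjMatrix_left ω).zero_or_one i j with h | h <;> simp [h]

theorem integral_right (h : IsCorrelatedBernoulli μ ρ Λ A B) {i j : Fin n} (hij : i ≠ j) :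
    ∫ ω, B ω i j ∂μ = Λ i j :=
  h.swap.integral_left hij

theorem integral_mul_of_lt (h : IsCorrelatedBernoulli μ ρ Λ A B) {i j k l : Fin n}
    (hij : i < j) (hkl : k < l) (hne : (i, j) ≠ (k, l)) :
    ∫ ω, A ω i j * B ω k l ∂μ = Λ i j * Λ k l := by
  have hind := h.indep.indepFun (i := ⟨(i, j), hij⟩) (j := ⟨(k, l), hkl⟩) (by simpa using hne)
  have hind' := hind.comp (φ := Prod.fst) (ψ := Prod.snd) measurable_fst measurable_snd
  have hmul := hind'.integral_fun_mul_eq_mul_integral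
    (h.measurable_left i j).aestronglyMeasurable (h.measurable_right k l).aestronglyMeasurable
  simp only [Function.comp_apply] at hmul
  rw [hmul, h.integral_left hij.ne, h.integral_right hkl.ne]

/-- Symmetry reduces to increasing pairs, where independence applies. A diagonal `q` must be
allowed, since a rearrangement can send an edge to the diagonal; both sides then vanish. -/
theorem integral_mul_of_ne (h : IsCorrelatedBernoulli μ ρ Λ A B) (hs : Λ.IsSymm)
    (h0 : ∀ i, Λ i i = 0) {p q : Fin n × Fin n} (hp : p.1 ≠ p.2) (hne : q ≠ p)
    (hne' : q ≠ p.swap) :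
    ∫ ω, A ω p.1 p.2 * B ω q.1 q.2 ∂μ = Λ p.1 p.2 * Λ q.1 q.2 := by
  obtain ⟨i, j⟩ := p
  obtain ⟨k, l⟩ := q
  simp only [ne_eq, Prod.mk.injEq, Prod.swap_prod_mk] at *
  have hA : ∀ ω, A ω j i = A ω i j := fun ω => (h.isAdjMatrix_left ω).symm.apply i j
  have hB : ∀ ω, B ω l k = B ω k l := fun ω => (h.isAdjMatrix_right ω).symm.apply k l
  rcases lt_trichotomy k l with hkl | rfl | hkl
  · rcases lt_or_gt_of_ne hp with hij | hij
    · exact h.integral_mul_of_lt hij hkl (by grind)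
    · rw [← hs.apply i j]
      simp only [← hA]
      exact h.integral_mul_of_lt hij hkl (by grind)
  · simp [h0, (h.isAdjMatrix_right _).apply_diag]
  · rcases lt_or_gt_of_ne hp with hij | hij
    · rw [← hs.apply k l]
      simp only [← hB]
      exact h.integral_mul_of_lt hij hkl (by grind)
    · rw [← hs.apply i j, ← hs.apply k l]
      simp only [← hA, ← hB]
      exact h.integral_mul_of_lt hij hkl (by grind)

variable [IsProbabilityMeasure μ]

theorem memLp_left (h : IsCorrelatedBernoulli μ ρ Λ A B) (i j : Fin n) :
    MemLp (fun ω => A ω i j) 2 μ :=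
  MemLp.of_bound (h.measurable_left i j).aestronglyMeasurable 1
    (ae_of_all _ fun ω => h.abs_left_le_one ω i j)

theorem variance_left (h : IsCorrelatedBernoulli μ ρ Λ A B) {i j : Fin n} (hij : i ≠ j) :
    Var[fun ω => A ω i j; μ] = Λ i j * (1 - Λ i j) := by
  rw [variance_eq_sub (h.memLp_left i j)]
  have : (fun ω => A ω i j) ^ 2 = fun ω => A ω i j := by
    funext ω
    simp only [Pi.pow_apply, sq, h.left_mul_self]
  rw [this, h.integral_left hij]
  ring

theorem integral_mul_self (h : IsCorrelatedBernoulli μ ρ Λ A B) {i j : Fin n} (hij : i ≠ j) :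
    ∫ ω, A ω i j * B ω i j ∂μ = Λ i j ^ 2 + ρ * (Λ i j * (1 - Λ i j)) := by
  have hc := h.correlation i j hij
  have h0 : 0 ≤ Λ i j * (1 - Λ i j) := by
    rw [← h.variance_left hij]
    exact variance_nonneg _ _
  rw [h.variance_left hij, h.swap.variance_left hij, Real.mul_self_sqrt h0,
    covariance_eq_sub (h.memLp_left i j) (h.swap.memLp_left i j), h.integral_left hij,
    h.integral_right hij] at hc
  simp only [Pi.mul_apply] at hc
  linarith

end IsCorrelatedBernoulli

/-! ### Mean gap of a rearrangement -/

/-- The ordered pairs of distinct vertices whose underlying unordered pair is changed by `π`. -/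
def movedPairs {n : ℕ} (π : Equiv.Perm (Fin n × Fin n)) : Finset (Fin n × Fin n) :=
  {p | p.1 ≠ p.2 ∧ π p ≠ p ∧ π p ≠ p.swap}

theorem mem_movedPairs {n : ℕ} {π : Equiv.Perm (Fin n × Fin n)} {p : Fin n × Fin n} :
    p ∈ movedPairs π ↔ p.1 ≠ p.2 ∧ π p ≠ p ∧ π p ≠ p.swap := by
  simp [movedPairs]

/-- Unmoved pairs contribute zero: either `M` vanishes on the diagonal, or symmetry of `N` cancels
the difference. -/
theorem sum_movedPairs_eq_sum {n : ℕ} {π : Equiv.Perm (Fin n × Fin n)}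
    {M N : Matrix (Fin n) (Fin n) ℝ} (hM : ∀ i, M i i = 0) (hN : N.IsSymm) :
    ∑ p ∈ movedPairs π, M p.1 p.2 * (N p.1 p.2 - N (π p).1 (π p).2) =
      ∑ p, M p.1 p.2 * (N p.1 p.2 - N (π p).1 (π p).2) := by
  refine Finset.sum_subset (Finset.subset_univ _) fun p _ hp => ?_
  rw [mem_movedPairs] at hp
  by_cases h1 : p.1 = p.2
  · rw [h1, hM, zero_mul]
  · by_cases h2 : π p = p
    · rw [h2, sub_self, mul_zero]
    · have h3 : π p = p.swap := by tauto
      rw [h3, Prod.fst_swap, Prod.snd_swap, hN.apply, sub_self, mul_zero]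

/-- Each term is half a square plus a difference that cancels when summed over the permutation. -/
theorem sum_mul_sub_comp_perm_nonneg {ι : Type*} [Fintype ι] (v : ι → ℝ) (π : Equiv.Perm ι) :
    0 ≤ ∑ p, v p * (v p - v (π p)) := by
  have h := Equiv.sum_comp π fun p => v p ^ 2
  have h2 : ∑ p, v p * (v p - v (π p)) = ∑ p, (v p - v (π p)) ^ 2 / 2 := by
    have h3 : ∀ p, v p * (v p - v (π p)) =
        (v p - v (π p)) ^ 2 / 2 + (v p ^ 2 / 2 - v (π p) ^ 2 / 2) := fun p => by ring
    simp only [h3]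
    rw [Finset.sum_add_distrib, Finset.sum_sub_distrib, add_eq_left, ← Finset.sum_div,
      ← Finset.sum_div, h, sub_self]
  rw [h2]
  positivity

namespace IsCorrelatedBernoulli

variable {Ω : Type*} [MeasurableSpace Ω] {μ : Measure Ω} [IsProbabilityMeasure μ] {n : ℕ} {ρ : ℝ}
  {Λ : Matrix (Fin n) (Fin n) ℝ} {A B : Ω → Matrix (Fin n) (Fin n) ℝ}

theorem integrable_mul (h : IsCorrelatedBernoulli μ ρ Λ A B) (p q : Fin n × Fin n) :
    Integrable (fun ω => A ω p.1 p.2 * B ω q.1 q.2) μ := by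
  refine integrable_of_measurable_of_abs_le (K := 1)
    ((h.measurable_left _ _).mul (h.measurable_right _ _)) fun ω => ?_
  rw [abs_mul]
  exact mul_le_one₀ (h.abs_left_le_one _ _ _) (abs_nonneg _) (h.swap.abs_left_le_one _ _ _)

/-- The agreement of `A` and `B` exceeds that of `A` and a rearrangement of `B` on average by at
least a constant for each pair that is rearranged. -/
theorem le_integral_sum_movedPairs (h : IsCorrelatedBernoulli μ ρ Λ A B) {α : ℝ} (hρ : 0 ≤ ρ)
    (hs : Λ.IsSymm) (h0 : ∀ i, Λ i i = 0) (hΛ : ∀ i j, i ≠ j → Λ i j ∈ Set.Icc α (1 - α))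
    (π : Equiv.Perm (Fin n × Fin n)) :
    ρ * (α * (1 - α)) * (movedPairs π).card ≤
      ∫ ω, ∑ p ∈ movedPairs π,
        A ω p.1 p.2 * (B ω p.1 p.2 - B ω (π p).1 (π p).2) ∂μ := by
  have hsum : ∫ ω, ∑ p ∈ movedPairs π, A ω p.1 p.2 * (B ω p.1 p.2 - B ω (π p).1 (π p).2) ∂μ =
      ∑ p ∈ movedPairs π,
        ∫ ω, A ω p.1 p.2 * B ω p.1 p.2 - A ω p.1 p.2 * B ω (π p).1 (π p).2 ∂μ := by
    have hi : ∀ p ∈ movedPairs π, Integrable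
        (fun ω => A ω p.1 p.2 * B ω p.1 p.2 - A ω p.1 p.2 * B ω (π p).1 (π p).2) μ := fun p _ =>
      (h.integrable_mul p p).sub (h.integrable_mul p (π p))
    rw [← integral_finsetSum _ hi]
    congr 1
    funext ω
    exact Finset.sum_congr rfl fun p _ => mul_sub _ _ _
  rw [hsum]
  have hterm : ∀ p ∈ movedPairs π,
      ρ * (α * (1 - α)) + Λ p.1 p.2 * (Λ p.1 p.2 - Λ (π p).1 (π p).2) ≤
      ∫ ω, A ω p.1 p.2 * B ω p.1 p.2 - A ω p.1 p.2 * B ω (π p).1 (π p).2 ∂μ := by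
    intro p hp
    obtain ⟨h1, h2, h3⟩ := mem_movedPairs.1 hp
    rw [integral_sub (h.integrable_mul p p) (h.integrable_mul p (π p)), h.integral_mul_self h1,
      h.integral_mul_of_ne hs h0 h1 h2 h3]
    obtain ⟨h4, h5⟩ := hΛ _ _ h1
    -- This is `(Λ - α)(1 - α - Λ) ≥ 0`.
    have h6 : α * (1 - α) ≤ Λ p.1 p.2 * (1 - Λ p.1 p.2) := by nlinarith
    nlinarith [mul_le_mul_of_nonneg_left h6 hρ]
  refine le_trans ?_ (Finset.sum_le_sum hterm)
  rw [Finset.sum_add_distrib, sum_movedPairs_eq_sum h0 hs, Finset.sum_const, nsmul_eq_mul]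
  have := sum_mul_sub_comp_perm_nonneg (fun p : Fin n × Fin n => Λ p.1 p.2) π
  have h2 : 0 ≤ ∑ p, Λ p.1 p.2 * (Λ p.1 p.2 - Λ (π p).1 (π p).2) := this
  linarith

end IsCorrelatedBernoulli

/-! ### Tail bound for a single rearrangement -/

/-- The index set of unordered pairs of distinct vertices. -/
abbrev EdgeIndex (n : ℕ) : Type := {p : Fin n × Fin n // p.1 < p.2}

/-- The symmetric matrix with zero diagonal and entries in `[0, 1]` with given values above the
diagonal, which are clipped to `[0, 1]`. -/
def symmOfEdges {n : ℕ} (x : EdgeIndex n → ℝ) (p : Fin n × Fin n) : ℝ :=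
  if h : p.1 < p.2 then max 0 (min (x ⟨p, h⟩) 1)
  else if h : p.2 < p.1 then max 0 (min (x ⟨p.swap, h⟩) 1) else 0

/-- Clipping makes this hold for every real vector, as the global bounds in McDiarmid's inequality
require. -/
theorem symmOfEdges_mem_Icc {n : ℕ} (x : EdgeIndex n → ℝ) (p : Fin n × Fin n) :
    symmOfEdges x p ∈ Set.Icc (0 : ℝ) 1 := by
  unfold symmOfEdges
  split_ifs <;> simp

theorem measurable_symmOfEdges {n : ℕ} (p : Fin n × Fin n) :
    Measurable fun x : EdgeIndex n → ℝ => symmOfEdges x p := by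
  unfold symmOfEdges
  split_ifs <;> fun_prop

theorem symmOfEdges_congr {n : ℕ} {x y : EdgeIndex n → ℝ} {e : EdgeIndex n} {p : Fin n × Fin n}
    (h : ∀ e', e' ≠ e → x e' = y e') (h1 : p ≠ e.1) (h2 : p ≠ e.1.swap) :
    symmOfEdges x p = symmOfEdges y p := by
  unfold symmOfEdges
  split_ifs with h3 h4
  · rw [h]
    rintro rfl
    exact h1 rfl
  · rw [h]
    rintro rfl
    simp at h2
  · rfl

theorem symmOfEdges_eq {n : ℕ} {M : Matrix (Fin n) (Fin n) ℝ} (hM : M.IsAdjMatrix)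
    (p : Fin n × Fin n) : symmOfEdges (fun e : EdgeIndex n => M e.1.1 e.1.2) p = M p.1 p.2 := by
  have h01 : ∀ i j, max 0 (min (M i j) 1) = M i j := fun i j => by
    rcases hM.zero_or_one i j with h | h <;> simp [h]
  unfold symmOfEdges
  split_ifs with h1 h2
  · exact h01 _ _
  · simp only [Prod.fst_swap, Prod.snd_swap, h01]
    exact hM.symm.apply _ _
  · rw [le_antisymm (not_lt.1 h2) (not_lt.1 h1), hM.apply_diag]

/-- The number of ways in which the unordered pair `e` is the pair of `p` or of `π p`. -/
def incidences {n : ℕ} (π : Equiv.Perm (Fin n × Fin n)) (e : EdgeIndex n) (p : Fin n × Fin n) :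
    ℝ :=
  (if p = e.1 then 1 else 0) + (if p = e.1.swap then 1 else 0) +
    ((if π p = e.1 then 1 else 0) + (if π p = e.1.swap then 1 else 0))

theorem incidences_nonneg {n : ℕ} (π : Equiv.Perm (Fin n × Fin n)) (e : EdgeIndex n)
    (p : Fin n × Fin n) : 0 ≤ incidences π e p := by
  unfold incidences
  positivity

/-- Each of the four indicators is nonzero for one `p` only, `π` being a bijection. -/
theorem sum_incidences_left_le {n : ℕ} (π : Equiv.Perm (Fin n × Fin n)) (e : EdgeIndex n)
    (s : Finset (Fin n × Fin n)) : ∑ p ∈ s, incidences π e p ≤ 4 := by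
  refine (Finset.sum_le_sum_of_subset_of_nonneg (Finset.subset_univ s)
    fun p _ _ => incidences_nonneg π e p).trans ?_
  unfold incidences
  simp only [Finset.sum_add_distrib, ← Equiv.eq_symm_apply, Finset.sum_ite_eq', Finset.mem_univ,
    if_true]
  norm_num

theorem sum_ite_eq_le_one {ι κ : Type*} [Fintype ι] [DecidableEq κ] {g : ι → κ}
    (hg : Function.Injective g) (q : κ) : ∑ e, (if q = g e then (1 : ℝ) else 0) ≤ 1 := by
  rw [Finset.sum_boole]
  have : (Finset.univ.filter fun e => q = g e).card ≤ 1 :=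
    Finset.card_le_one.2 fun a ha b hb => hg (by simp at ha hb; rw [← ha, ← hb])
  exact_mod_cast this

theorem sum_incidences_right_le {n : ℕ} (π : Equiv.Perm (Fin n × Fin n)) (p : Fin n × Fin n) :
    ∑ e, incidences π e p ≤ 4 := by
  unfold incidences
  simp only [Finset.sum_add_distrib]
  have h1 : Function.Injective fun e : EdgeIndex n => e.1 := Subtype.val_injective
  have h2 : Function.Injective fun e : EdgeIndex n => e.1.swap :=
    Prod.swap_injective.comp Subtype.val_injective
  linarith [sum_ite_eq_le_one h1 p, sum_ite_eq_le_one h2 p, sum_ite_eq_le_one h1 (π p),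
    sum_ite_eq_le_one h2 (π p)]

theorem abs_mul_sub_le_one {a b c : ℝ} (ha : a ∈ Set.Icc (0 : ℝ) 1) (hb : b ∈ Set.Icc (0 : ℝ) 1)
    (hc : c ∈ Set.Icc (0 : ℝ) 1) : |a * (b - c)| ≤ 1 := by
  rw [abs_mul]
  refine mul_le_one₀ (abs_le.2 ⟨by linarith [ha.1], ha.2⟩) (abs_nonneg _) (abs_le.2 ⟨?_, ?_⟩)
  · linarith [hb.1, hc.2]
  · linarith [hb.2, hc.1]

namespace IsCorrelatedBernoulli

variable {Ω : Type*} [MeasurableSpace Ω] {μ : Measure Ω} [IsProbabilityMeasure μ] {n : ℕ} {ρ : ℝ}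
  {Λ : Matrix (Fin n) (Fin n) ℝ} {A B : Ω → Matrix (Fin n) (Fin n) ℝ}

/-- A rearrangement of `B` agrees with `A` at least as well as `B` itself only with probability
exponentially small in the number of pairs that are rearranged. -/
theorem measureReal_sum_mul_le_le (h : IsCorrelatedBernoulli μ ρ Λ A B) {α : ℝ} (hρ : 0 ≤ ρ)
    (hα : α ∈ Set.Icc (0 : ℝ) 1) (hs : Λ.IsSymm) (h0 : ∀ i, Λ i i = 0)
    (hΛ : ∀ i j, i ≠ j → Λ i j ∈ Set.Icc α (1 - α)) (π : Equiv.Perm (Fin n × Fin n)) :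
    μ.real {ω | ∑ p : Fin n × Fin n, A ω p.1 p.2 * B ω p.1 p.2 ≤
        ∑ p : Fin n × Fin n, A ω p.1 p.2 * B ω (π p).1 (π p).2} ≤
      Real.exp (-((ρ * (α * (1 - α))) ^ 2 / 32 * (movedPairs π).card)) := by
  -- If nothing moves the bound is `1`; otherwise the variance proxy is positive.
  rcases (movedPairs π).eq_empty_or_nonempty with hM | hM
  · simp [hM]
  have hcard : (0 : ℝ) < (movedPairs π).card := by exact_mod_cast hM.card_pos
  set term : (Fin n × Fin n) → (EdgeIndex n → ℝ × ℝ) → ℝ := fun p x =>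
    symmOfEdges (fun e => (x e).1) p *
      (symmOfEdges (fun e => (x e).2) p - symmOfEdges (fun e => (x e).2) (π p)) with hterm
  set f : (EdgeIndex n → ℝ × ℝ) → ℝ := fun x => ∑ p ∈ movedPairs π, term p x with hf
  set X : EdgeIndex n → Ω → ℝ × ℝ := fun e ω => (A ω e.1.1 e.1.2, B ω e.1.1 e.1.2) with hX
  have hterm1 : ∀ p x, |term p x| ≤ 1 := fun p x => abs_mul_sub_le_one
    (symmOfEdges_mem_Icc _ _) (symmOfEdges_mem_Icc _ _) (symmOfEdges_mem_Icc _ _)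
  have htermm : ∀ p, Measurable (term p) := fun p => by
    have h1 : ∀ q, Measurable fun x : EdgeIndex n → ℝ × ℝ => symmOfEdges (fun e => (x e).1) q :=
      fun q => (measurable_symmOfEdges q).comp (measurable_pi_lambda _ fun e => measurable_fst.comp (measurable_pi_apply e))
    have h2 : ∀ q, Measurable fun x : EdgeIndex n → ℝ × ℝ => symmOfEdges (fun e => (x e).2) q :=
      fun q => (measurable_symmOfEdges q).comp (measurable_pi_lambda _ fun e => measurable_snd.comp (measurable_pi_apply e))
    exact (h1 p).mul ((h2 p).sub (h2 _))
  have hfX : ∀ ω, f (fun e => X e ω) = ∑ p ∈ movedPairs π,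
      A ω p.1 p.2 * (B ω p.1 p.2 - B ω (π p).1 (π p).2) := fun ω => by
    simp only [hf, hterm, hX, symmOfEdges_eq (h.isAdjMatrix_left ω),
      symmOfEdges_eq (h.isAdjMatrix_right ω)]
  -- Only terms incident to `e` can change, each by at most `2`.
  have hdiff : ∀ x e y, |f (Function.update x e y) - f x| ≤
      2 * ∑ p ∈ movedPairs π, incidences π e p := by
    intro x e y
    rw [hf]
    simp only
    rw [← Finset.sum_sub_distrib, Finset.mul_sum]
    refine (Finset.abs_sum_le_sum_abs _ _).trans (Finset.sum_le_sum fun p _ => ?_)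
    by_cases hp : p = e.1 ∨ p = e.1.swap ∨ π p = e.1 ∨ π p = e.1.swap
    · have : 1 ≤ incidences π e p := by
        unfold incidences
        have : ∀ P : Prop, [Decidable P] → (0 : ℝ) ≤ if P then 1 else 0 := fun P _ => by
          positivity
        rcases hp with hp | hp | hp | hp <;> rw [if_pos hp] <;>
          linarith [this (p = e.1), this (p = e.1.swap), this (π p = e.1), this (π p = e.1.swap)]
      refine (abs_sub _ _).trans ?_
      linarith [hterm1 p x, hterm1 p (Function.update x e y)]
    · push Not at hp
      obtain ⟨h1, h2, h3, h4⟩ := hp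
      have h5 : ∀ e', e' ≠ e → (Function.update x e y e').1 = (x e').1 := fun e' he' => by
        rw [Function.update_of_ne he']
      have h6 : ∀ e', e' ≠ e → (Function.update x e y e').2 = (x e').2 := fun e' he' => by
        rw [Function.update_of_ne he']
      have : term p (Function.update x e y) = term p x := by
        simp only [hterm]
        rw [symmOfEdges_congr h5 h1 h2, symmOfEdges_congr h6 h1 h2, symmOfEdges_congr h6 h3 h4]
      rw [this, sub_self, abs_zero]
      exact mul_nonneg zero_le_two (incidences_nonneg π e p)
  -- With `s ≤ 4` the incidence sum, `(2 s)² ≤ 16 s`; double counting then gives at most `4`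
  -- incidences per moved pair.
  have hsq : ∑ e : EdgeIndex n, (2 * ∑ p ∈ movedPairs π, incidences π e p) ^ 2 ≤
      64 * ((movedPairs π).card : ℝ) := by
    calc ∑ e : EdgeIndex n, (2 * ∑ p ∈ movedPairs π, incidences π e p) ^ 2
        ≤ ∑ e : EdgeIndex n, 16 * ∑ p ∈ movedPairs π, incidences π e p := by
          refine Finset.sum_le_sum fun e _ => ?_
          have h1 := sum_incidences_left_le π e (movedPairs π)
          have h2 : 0 ≤ ∑ p ∈ movedPairs π, incidences π e p :=
            Finset.sum_nonneg fun p _ => incidences_nonneg π e p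
          nlinarith
      _ = 16 * ∑ p ∈ movedPairs π, ∑ e, incidences π e p := by
          rw [← Finset.mul_sum, Finset.sum_comm]
      _ ≤ 16 * ∑ p ∈ movedPairs π, (4 : ℝ) := by
          gcongr with p _
          exact sum_incidences_right_le π p
      _ = 64 * (movedPairs π).card := by
          rw [Finset.sum_const, nsmul_eq_mul]
          ring
  have hmean := h.le_integral_sum_movedPairs hρ hs h0 hΛ π
  simp only [← hfX] at hmean
  have hmc := measureReal_nonpos_le_of_bounded_differences (X := X)
    (fun e => (h.measurable_left _ _).prodMk (h.measurable_right _ _)) h.indep (f := f)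
    (Finset.measurable_sum _ fun p _ => htermm p) (K := (movedPairs π).card)
    (fun x => (Finset.abs_sum_le_sum_abs _ _).trans
      ((Finset.sum_le_sum fun p _ => hterm1 p x).trans (by simp)))
    hdiff (mul_nonneg (mul_nonneg hρ (mul_nonneg hα.1 (by linarith [hα.2]))) hcard.le)
    (by positivity) hsq hmean
  have hset : {ω | ∑ p : Fin n × Fin n, A ω p.1 p.2 * B ω p.1 p.2 ≤
      ∑ p : Fin n × Fin n, A ω p.1 p.2 * B ω (π p).1 (π p).2} =
      {ω | f (fun e => X e ω) ≤ 0} := by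
    ext ω
    simp only [Set.mem_ofPred_eq, hfX]
    rw [sum_movedPairs_eq_sum (h.isAdjMatrix_left ω).apply_diag (h.isAdjMatrix_right ω).symm]
    simp only [mul_sub, Finset.sum_sub_distrib, sub_nonpos]
  rw [hset]
  refine hmc.trans (le_of_eq ?_)
  congr 2
  field_simp
  ring

end IsCorrelatedBernoulli

/-! ### Counting moved pairs and summing over permutations -/

/-- If `σ i ≠ i`, then `(i, j)` is moved for every `j` outside `{i, σ i}`: the new first coordinate
is neither `i` nor `j`. -/
theorem card_support_mul_le_card_movedPairs {n : ℕ} (σ τ : Equiv.Perm (Fin n)) :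
    σ.support.card * (n - 2) ≤ (movedPairs (Equiv.prodCongr σ τ)).card := by
  have hsub : (σ.support.sigma fun i => (Finset.univ \ {i, σ i} : Finset (Fin n))).map
      (Equiv.sigmaEquivProd _ _).toEmbedding ⊆ movedPairs (Equiv.prodCongr σ τ) := by
    intro p hp
    obtain ⟨i, j⟩ := p
    simp only [Finset.mem_map_equiv, Equiv.sigmaEquivProd_symm_apply, Finset.mem_sigma,
      Equiv.Perm.mem_support, Finset.mem_sdiff, Finset.mem_univ, Finset.mem_insert,
      Finset.mem_singleton, true_and, not_or] at hp
    rw [mem_movedPairs]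
    simp only [Equiv.prodCongr_apply, Prod.map_apply, Prod.swap_prod_mk, ne_eq, Prod.mk.injEq]
    grind
  refine le_trans ?_ (Finset.card_le_card hsub)
  rw [Finset.card_map, Finset.card_sigma, ← smul_eq_mul]
  refine Finset.card_nsmul_le_sum _ _ _ fun i _ => ?_
  rw [Finset.card_univ_sdiff, Fintype.card_fin]
  exact Nat.sub_le_sub_left Finset.card_le_two _

theorem card_support_mul_le_card_movedPairs' {n : ℕ} (σ τ : Equiv.Perm (Fin n)) :
    τ.support.card * (n - 2) ≤ (movedPairs (Equiv.prodCongr σ τ)).card := by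
  refine (card_support_mul_le_card_movedPairs τ σ).trans ?_
  refine Finset.card_le_card_of_injOn Prod.swap (fun p hp => ?_) Prod.swap_injective.injOn
  obtain ⟨i, j⟩ := p
  rw [Finset.mem_coe, mem_movedPairs] at hp ⊢
  simp only [Equiv.prodCongr_apply, Prod.map_apply, Prod.swap_prod_mk, ne_eq,
    Prod.mk.injEq] at hp ⊢
  grind

/-- Average the bounds for `σ` and `τ`, using `n - 2 ≥ n / 2` for `n ≥ 4`. -/
theorem card_support_add_mul_le_card_movedPairs {n : ℕ} (hn : 4 ≤ n) (σ τ : Equiv.Perm (Fin n)) :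
    ((σ.support.card + τ.support.card : ℕ) : ℝ) * (n / 4) ≤
      (movedPairs (Equiv.prodCongr σ τ)).card := by
  have h1 := card_support_mul_le_card_movedPairs σ τ
  have h2 := card_support_mul_le_card_movedPairs' σ τ
  have h3 : (σ.support.card + τ.support.card) * (n - 2) ≤
      2 * (movedPairs (Equiv.prodCongr σ τ)).card := by
    rw [add_mul]
    omega
  have h4 : (σ.support.card + τ.support.card) * n ≤
      (σ.support.card + τ.support.card) * (2 * (n - 2)) := Nat.mul_le_mul_left _ (by omega)
  have h5 : (σ.support.card + τ.support.card) * n ≤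
      4 * (movedPairs (Equiv.prodCongr σ τ)).card := by
    rw [mul_left_comm] at h4
    omega
  have h6 : ((σ.support.card + τ.support.card : ℕ) : ℝ) * n ≤
      4 * ((movedPairs (Equiv.prodCongr σ τ)).card : ℝ) := by exact_mod_cast h5
  linarith

/-- The generating function of permutations by the number of points that they move. -/
theorem sum_perm_pow_card_support_le {n : ℕ} {x : ℝ} (hx : 0 ≤ x) :
    ∑ σ : Equiv.Perm (Fin n), x ^ σ.support.card ≤ (1 + n * x) ^ n := by
  -- The power is a product of these weights along `σ`. Enlarging the sum to all functions makes it
  -- factor over rows.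
  set w : Fin n → Fin n → ℝ := fun i j => if j ≠ i then x else 1 with hw
  have hw0 : ∀ i j, 0 ≤ w i j := fun i j => by
    simp only [hw]
    split_ifs <;> linarith
  calc ∑ σ : Equiv.Perm (Fin n), x ^ σ.support.card
      = ∑ σ : Equiv.Perm (Fin n), ∏ i, w i (σ i) := by
        refine Finset.sum_congr rfl fun σ _ => ?_
        rw [hw, Finset.prod_ite, Finset.prod_const, Finset.prod_const_one, mul_one]
        rfl
    _ = ∑ f ∈ (Finset.univ : Finset (Equiv.Perm (Fin n))).map ⟨_, DFunLike.coe_injective⟩,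
          ∏ i, w i (f i) := by
        rw [Finset.sum_map]
        rfl
    _ ≤ ∑ f : Fin n → Fin n, ∏ i, w i (f i) :=
        Finset.sum_le_sum_of_subset_of_nonneg (Finset.subset_univ _) fun f _ _ =>
          Finset.prod_nonneg fun i _ => hw0 _ _
    _ = ∏ i, ∑ j, w i j := by
        rw [Finset.prod_univ_sum, Fintype.piFinset_univ]
    _ ≤ ∏ _i : Fin n, (1 + n * x) := by
        refine Finset.prod_le_prod (fun i _ => Finset.sum_nonneg fun j _ => hw0 i j) fun i _ => ?_
        calc ∑ j, w i j ≤ ∑ j, ((if j = i then 1 else 0) + x) := by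
              refine Finset.sum_le_sum fun j _ => ?_
              by_cases h : j = i <;> simp [hw, h, hx]
          _ = 1 + n * x := by
              simp [Finset.sum_add_distrib]
    _ = (1 + n * x) ^ n := by simp

/-- With `x = exp (-c n)`, the square is at most `exp (2 n² x)`, and `exp y - 1 ≤ 2 y` for `0 ≤ y ≤
1`; so `4 n² x` dominates eventually. -/
theorem summable_one_add_mul_exp_pow_sub_one {c : ℝ} (hc : 0 < c) :
    Summable fun n : ℕ => ((1 + n * Real.exp (-c * n)) ^ n) ^ 2 - 1 := by
  have hs := Real.summable_pow_mul_exp_neg_nat_mul 2 hc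
  refine Summable.of_norm_bounded_eventually_nat (hs.mul_left 4) ?_
  filter_upwards [hs.tendsto_atTop_zero.eventually_le_const (show (0 : ℝ) < 1 / 2 by norm_num)]
    with n hn
  set x := Real.exp (-c * n) with hx
  have hx0 : 0 < x := Real.exp_pos _
  have h1 : 1 ≤ ((1 + n * x) ^ n) ^ 2 :=
    one_le_pow₀ (one_le_pow₀ (by linarith [show (0 : ℝ) ≤ n * x by positivity]))
  have h2 : ((1 + n * x) ^ n) ^ 2 ≤ Real.exp (2 * (n ^ 2 * x)) := by
    calc ((1 + n * x) ^ n) ^ 2 ≤ (Real.exp (n * x) ^ n) ^ 2 := by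
          gcongr
          linarith [Real.add_one_le_exp (n * x)]
      _ = Real.exp (2 * (n ^ 2 * x)) := by
          rw [← pow_mul, ← Real.exp_nat_mul]
          congr 1
          push_cast
          ring
  have h3 : 0 ≤ 2 * (n ^ 2 * x) := by positivity
  have h4 := Real.abs_exp_sub_one_le (x := 2 * (n ^ 2 * x)) (by
    rw [abs_of_nonneg h3]
    linarith)
  rw [abs_of_nonneg h3] at h4
  rw [Real.norm_of_nonneg (by linarith)]
  linarith [le_abs_self (Real.exp (2 * (n ^ 2 * x)) - 1)]

/-- First Borel–Cantelli lemma; no independence across `n` is needed. -/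
theorem ae_eventually_notMem_of_summable_real {Ω : Type*} [MeasurableSpace Ω] {μ : Measure Ω}
    [IsProbabilityMeasure μ] {s : ℕ → Set Ω} {u : ℕ → ℝ} (hu : Summable u)
    (hs : ∀ᶠ n in atTop, μ.real (s n) ≤ u n) : ∀ᵐ ω ∂μ, ∀ᶠ n in atTop, ω ∉ s n := by
  have h : Summable fun n => μ.real (s n) := by
    refine Summable.of_norm_bounded_eventually_nat hu ?_
    filter_upwards [hs] with n hn
    rwa [Real.norm_of_nonneg measureReal_nonneg]
  refine ae_eventually_notMem ?_
  have h2 : ∀ n, μ (s n) = ENNReal.ofReal (μ.real (s n)) := fun n => by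
    rw [ofReal_measureReal]
  simp only [h2]
  exact h.tsum_ofReal_ne_top

/-! ### Probabilities of the two exceptional events -/

namespace IsCorrelatedBernoulli

variable {Ω : Type*} [MeasurableSpace Ω] {μ : Measure Ω} [IsProbabilityMeasure μ] {n : ℕ} {ρ : ℝ}
  {Λ : Matrix (Fin n) (Fin n) ℝ} {A B : Ω → Matrix (Fin n) (Fin n) ℝ}

/-- Union bound: the sum over pairs factors into a square of the generating function, and omitting
the identity pair subtracts `1`. -/
theorem measureReal_exists_perm_le (h : IsCorrelatedBernoulli μ ρ Λ A B) {α : ℝ} (hρ : 0 ≤ ρ)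
    (hα : α ∈ Set.Icc (0 : ℝ) 1) (hs : Λ.IsSymm) (h0 : ∀ i, Λ i i = 0)
    (hΛ : ∀ i j, i ≠ j → Λ i j ∈ Set.Icc α (1 - α)) (hn : 4 ≤ n) :
    μ.real {ω | ∃ σ τ : Equiv.Perm (Fin n), (σ, τ) ≠ 1 ∧
        ∑ p : Fin n × Fin n, A ω p.1 p.2 * B ω p.1 p.2 ≤
          ∑ p : Fin n × Fin n, A ω p.1 p.2 * B ω (σ p.1) (τ p.2)} ≤
      ((1 + n * Real.exp (-((ρ * (α * (1 - α))) ^ 2 / 128) * n)) ^ n) ^ 2 - 1 := by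
  set x := Real.exp (-((ρ * (α * (1 - α))) ^ 2 / 128) * n) with hx
  set bad : Equiv.Perm (Fin n) × Equiv.Perm (Fin n) → Set Ω := fun q =>
    {ω | ∑ p : Fin n × Fin n, A ω p.1 p.2 * B ω p.1 p.2 ≤
      ∑ p : Fin n × Fin n, A ω p.1 p.2 * B ω (q.1 p.1) (q.2 p.2)} with hbad
  have hsub : {ω | ∃ σ τ : Equiv.Perm (Fin n), (σ, τ) ≠ 1 ∧
        ∑ p : Fin n × Fin n, A ω p.1 p.2 * B ω p.1 p.2 ≤
          ∑ p : Fin n × Fin n, A ω p.1 p.2 * B ω (σ p.1) (τ p.2)} ⊆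
      ⋃ q ∈ Finset.univ.erase (1 : Equiv.Perm (Fin n) × Equiv.Perm (Fin n)), bad q := by
    rintro ω ⟨σ, τ, hne, hω⟩
    simp only [Set.mem_iUnion]
    exact ⟨(σ, τ), by simpa using hne, hω⟩
  have hq : ∀ q, μ.real (bad q) ≤ x ^ q.1.support.card * x ^ q.2.support.card := by
    intro q
    refine (h.measureReal_sum_mul_le_le hρ hα hs h0 hΛ (Equiv.prodCongr q.1 q.2)).trans ?_
    rw [← pow_add, hx, ← Real.exp_nat_mul]
    refine Real.exp_le_exp.2 ?_
    have h1 := mul_le_mul_of_nonneg_left (card_support_add_mul_le_card_movedPairs hn q.1 q.2)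
      (show 0 ≤ (ρ * (α * (1 - α))) ^ 2 / 32 by positivity)
    linarith
  refine (measureReal_mono hsub (measure_ne_top _ _)).trans ((measureReal_biUnion_finset_le _ _).trans ?_)
  refine (Finset.sum_le_sum fun q _ => hq q).trans ?_
  rw [Finset.sum_erase_eq_sub (Finset.mem_univ _), Fintype.sum_prod_type]
  simp only [Prod.fst_one, Prod.snd_one, Equiv.Perm.support_one, Finset.card_empty, pow_zero,
    mul_one, ← Finset.mul_sum, ← Finset.sum_mul]
  rw [← sq]
  have hnn : 0 ≤ ∑ σ : Equiv.Perm (Fin n), x ^ σ.support.card := by positivity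
  have := sum_perm_pow_card_support_le (n := n) (Real.exp_pos _).le (x := x)
  gcongr

/-- For 0/1 values disagreement is `A + B - 2AB`, of mean `2 (1 - ρ) Λ (1 - Λ)`. -/
theorem measureReal_left_eq_right_le (h : IsCorrelatedBernoulli μ ρ Λ A B) {α : ℝ} (hρ : ρ ≤ 1)
    (hΛ : ∀ i j, i ≠ j → Λ i j ∈ Set.Icc α (1 - α)) {i j : Fin n} (hij : i ≠ j) :
    μ.real {ω | A ω i j = B ω i j} ≤ 1 - 2 * (α * (1 - α)) * (1 - ρ) := by
  have hm : MeasurableSet {ω | A ω i j = B ω i j} :=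
    measurableSet_eq_fun (h.measurable_left i j) (h.measurable_right i j)
  have hind : ∀ ω, {ω | A ω i j = B ω i j}.indicator (1 : Ω → ℝ) ω =
      1 - (A ω i j + B ω i j - 2 * (A ω i j * B ω i j)) := by
    intro ω
    rcases (h.isAdjMatrix_left ω).zero_or_one i j with h1 | h1 <;>
    rcases (h.isAdjMatrix_right ω).zero_or_one i j with h2 | h2 <;>
    norm_num [h1, h2, Set.indicator]
  have hA : Integrable (fun ω => A ω i j) μ := (h.memLp_left i j).integrable one_le_two
  have hB : Integrable (fun ω => B ω i j) μ := (h.swap.memLp_left i j).integrable one_le_two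
  have hAB : Integrable (fun ω => 2 * (A ω i j * B ω i j)) μ :=
    (h.integrable_mul (i, j) (i, j)).const_mul 2
  have hABs : Integrable (fun ω => A ω i j + B ω i j) μ := hA.add hB
  have hABt : Integrable (fun ω => A ω i j + B ω i j - 2 * (A ω i j * B ω i j)) μ :=
    hABs.sub hAB
  rw [← integral_indicator_one hm]
  simp only [hind]
  rw [integral_sub (integrable_const _) hABt, integral_sub hABs hAB, integral_add hA hB,
    integral_const_mul, h.integral_left hij, h.integral_right hij, h.integral_mul_self hij]
  obtain ⟨h4, h5⟩ := hΛ _ _ hij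
  have h6 : α * (1 - α) ≤ Λ i j * (1 - Λ i j) := by nlinarith
  have h7 := mul_le_mul_of_nonneg_right h6 (sub_nonneg.2 hρ)
  simp only [integral_const, probReal_univ, smul_eq_mul]
  nlinarith

/-- The `n - 1` edges at vertex `0` are independent, and all must agree. -/
theorem measureReal_eq_le (h : IsCorrelatedBernoulli μ ρ Λ A B) {α : ℝ} (hρ : ρ ≤ 1)
    (hΛ : ∀ i j, i ≠ j → Λ i j ∈ Set.Icc α (1 - α)) :
    μ.real {ω | A ω = B ω} ≤ (1 - 2 * (α * (1 - α)) * (1 - ρ)) ^ (n - 1) := by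
  rcases n with _ | m
  · simp
  set e : Fin m → EdgeIndex (m + 1) := fun k => ⟨(0, k.succ), Fin.succ_pos k⟩ with he
  have hinj : Function.Injective e := fun k l hkl => by
    simpa [he] using hkl
  have hind := (h.indep.precomp hinj).measure_inter_preimage_eq_mul Finset.univ
    (sets := fun _ => {p : ℝ × ℝ | p.1 = p.2}) fun k _ =>
      measurableSet_eq_fun measurable_fst measurable_snd
  have hsub : {ω | A ω = B ω} ⊆ ⋂ k ∈ (Finset.univ : Finset (Fin m)),
      (fun ω => (A ω (e k).1.1 (e k).1.2, B ω (e k).1.1 (e k).1.2)) ⁻¹'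
        {p : ℝ × ℝ | p.1 = p.2} := by
    intro ω hω
    simp only [Set.mem_iInter]
    intro k _
    exact congrFun (congrFun hω _) _
  refine (measureReal_mono hsub).trans ?_
  have hreal := congrArg ENNReal.toReal hind
  rw [ENNReal.toReal_prod] at hreal
  refine (le_of_eq hreal).trans ?_
  calc _ ≤ ∏ _k : Fin m, (1 - 2 * (α * (1 - α)) * (1 - ρ)) :=
        Finset.prod_le_prod (fun k _ => ENNReal.toReal_nonneg) fun k _ =>
          h.measureReal_left_eq_right_le hρ hΛ (Fin.succ_ne_zero k).symm
    _ = _ := by simp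

end IsCorrelatedBernoulli

/-! ### Trace inner product and Frobenius norm -/

section MatrixInner

variable {n : ℕ}

theorem matrixInner_eq_sum (C D : Matrix (Fin n) (Fin n) ℝ) :
    matrixInner C D = ∑ i, ∑ j, C i j * D i j := by
  simp only [matrixInner, Matrix.trace, Matrix.diag_apply, Matrix.mul_apply,
    Matrix.transpose_apply]
  exact Finset.sum_comm

theorem matrixInner_comm (C D : Matrix (Fin n) (Fin n) ℝ) :
    matrixInner C D = matrixInner D C := by
  simp only [matrixInner_eq_sum, mul_comm]

theorem matrixInner_add_left (C D E : Matrix (Fin n) (Fin n) ℝ) :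
    matrixInner (C + D) E = matrixInner C E + matrixInner D E := by
  simp [matrixInner, Matrix.add_mul]

theorem matrixInner_sub_left (C D E : Matrix (Fin n) (Fin n) ℝ) :
    matrixInner (C - D) E = matrixInner C E - matrixInner D E := by
  simp [matrixInner, Matrix.sub_mul]

theorem matrixInner_smul_left (t : ℝ) (C D : Matrix (Fin n) (Fin n) ℝ) :
    matrixInner (t • C) D = t * matrixInner C D := by
  simp [matrixInner]

theorem matrixInner_add_right (C D E : Matrix (Fin n) (Fin n) ℝ) :
    matrixInner C (D + E) = matrixInner C D + matrixInner C E := by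
  simp [matrixInner, Matrix.mul_add]

theorem matrixInner_sub_right (C D E : Matrix (Fin n) (Fin n) ℝ) :
    matrixInner C (D - E) = matrixInner C D - matrixInner C E := by
  simp [matrixInner, Matrix.mul_sub]

theorem matrixInner_smul_right (t : ℝ) (C D : Matrix (Fin n) (Fin n) ℝ) :
    matrixInner C (t • D) = t * matrixInner C D := by
  simp [matrixInner]

theorem matrixInner_sum_smul {ι κ : Type*} [Fintype ι] [Fintype κ] (v : ι → ℝ) (w : κ → ℝ)
    (C : ι → Matrix (Fin n) (Fin n) ℝ) (D : κ → Matrix (Fin n) (Fin n) ℝ) :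
    matrixInner (∑ a, v a • C a) (∑ b, w b • D b) =
      ∑ a, ∑ b, v a * w b * matrixInner (C a) (D b) := by
  simp only [matrixInner, Matrix.transpose_sum, Matrix.transpose_smul, Matrix.sum_mul,
    Matrix.trace_sum, Matrix.smul_mul, Matrix.mul_smul, Matrix.trace_smul, smul_eq_mul,
    Finset.mul_sum]
  rw [Finset.sum_comm]
  exact Finset.sum_congr rfl fun a _ => Finset.sum_congr rfl fun b _ => by ring

theorem matrixInner_self_pos {C : Matrix (Fin n) (Fin n) ℝ} (hC : C ≠ 0) :
    0 < matrixInner C C := by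
  rw [matrixInner_eq_sum]
  obtain ⟨i, j, hij⟩ : ∃ i j, C i j ≠ 0 := by
    by_contra! h
    exact hC (Matrix.ext h)
  refine Finset.sum_pos' (fun i _ => Finset.sum_nonneg fun j _ => mul_self_nonneg _)
    ⟨i, Finset.mem_univ _, Finset.sum_pos' (fun j _ => mul_self_nonneg _)
      ⟨j, Finset.mem_univ _, mul_self_pos.2 hij⟩⟩

theorem matrixInner_self_nonneg (C : Matrix (Fin n) (Fin n) ℝ) : 0 ≤ matrixInner C C := by
  rw [matrixInner_eq_sum]
  exact Finset.sum_nonneg fun i _ => Finset.sum_nonneg fun j _ => mul_self_nonneg _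

section

attribute [local instance] Matrix.frobeniusNormedAddCommGroup

theorem frobeniusNorm_eq_sqrt (M : Matrix (Fin n) (Fin n) ℝ) :
    frobeniusNorm M = √(matrixInner M M) := by
  rw [frobeniusNorm, Matrix.frobenius_norm_def, Real.sqrt_eq_rpow, matrixInner_eq_sum]
  simp only [Real.rpow_two, Real.norm_eq_abs, sq, abs_mul_abs_self]

end

theorem matrixInner_mul_mul_of_transpose_mul_self {P : Matrix (Fin n) (Fin n) ℝ} (hP : Pᵀ * P = 1)
    (C D : Matrix (Fin n) (Fin n) ℝ) : matrixInner (P * C) (P * D) = matrixInner C D := by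
  rw [matrixInner, Matrix.transpose_mul, Matrix.mul_assoc, ← Matrix.mul_assoc Pᵀ, hP,
    Matrix.one_mul, matrixInner]

theorem transpose_permMatrix_mul_self (σ : Equiv.Perm (Fin n)) :
    (σ.permMatrix ℝ)ᵀ * σ.permMatrix ℝ = 1 := by
  rw [Matrix.transpose_permMatrix, ← Matrix.permMatrix_mul, mul_inv_cancel, Matrix.permMatrix_one]

theorem permMatrix_mul_transpose_self (σ : Equiv.Perm (Fin n)) :
    σ.permMatrix ℝ * (σ.permMatrix ℝ)ᵀ = 1 := by
  rw [Matrix.transpose_permMatrix, ← Matrix.permMatrix_mul, inv_mul_cancel, Matrix.permMatrix_one]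

end MatrixInner

theorem argminSet_eq_singleton {X : Type*} {f : X → ℝ} {s : Set X} {a : X} (ha : a ∈ s)
    (h : ∀ x ∈ s, x ≠ a → f a < f x) : argminSet f s = {a} := by
  ext x
  constructor
  · rintro ⟨hx, hmin⟩
    by_contra hne
    exact absurd (h x hx hne) (not_lt.2 (hmin ha))
  · rintro rfl
    refine ⟨ha, fun y hy => ?_⟩
    by_cases hy' : y = x
    · exact (congrArg f hy').ge
    · exact (h y hy hy').le

/-! ### Deterministic optimality of the indefinite relaxation -/

section Deterministic

variable {n : ℕ}

/-- The two factors permute columns and rows of `B` separately, which is why pairs `(σ, τ)` must be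
handled. -/
theorem matrixInner_mul_permMatrix_permMatrix_mul (A B : Matrix (Fin n) (Fin n) ℝ)
    (σ τ : Equiv.Perm (Fin n)) :
    matrixInner (A * σ.permMatrix ℝ) (τ.permMatrix ℝ * B) =
      ∑ p : Fin n × Fin n, A p.1 p.2 * B (τ p.1) (σ p.2) := by
  rw [matrixInner_eq_sum, Fintype.sum_prod_type, Equiv.Perm.permMatrix, Equiv.Perm.permMatrix,
    PEquiv.mul_toMatrix_toPEquiv, PEquiv.toMatrix_toPEquiv_mul]
  refine Finset.sum_congr rfl fun i _ => ?_
  rw [← Equiv.sum_comp σ]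
  simp

/-- If all rearrangements of `B` agree less well with `A` than `B` itself, then the identity is the
strict maximizer of the relaxed agreement. -/
theorem matrixInner_mul_mul_lt_of_ne_one {A B : Matrix (Fin n) (Fin n) ℝ}
    (hAB : ∀ σ τ : Equiv.Perm (Fin n), (σ, τ) ≠ 1 →
      ∑ p : Fin n × Fin n, A p.1 p.2 * B (σ p.1) (τ p.2) <
        ∑ p : Fin n × Fin n, A p.1 p.2 * B p.1 p.2)
    {E : Matrix (Fin n) (Fin n) ℝ} (hE : E ∈ doublyStochastic ℝ (Fin n)) (hne : E ≠ 1) :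
    matrixInner (A * E) (E * B) < matrixInner (A * 1) (1 * B) := by
  obtain ⟨w, hw0, hw1, hwE⟩ := exists_eq_sum_perm_of_mem_doublyStochastic hE
  have hone : matrixInner (A * 1) (1 * B) = ∑ p : Fin n × Fin n, A p.1 p.2 * B p.1 p.2 := by
    rw [Matrix.mul_one, Matrix.one_mul, matrixInner_eq_sum, Fintype.sum_prod_type]
  set S := ∑ p : Fin n × Fin n, A p.1 p.2 * B p.1 p.2 with hS
  -- Since `E ≠ 1`, some nonidentity `σ` carries weight; its diagonal term `(σ, σ)` makes the
  -- inequality strict.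
  obtain ⟨σ, hσ1, hσ⟩ : ∃ σ, σ ≠ 1 ∧ 0 < w σ := by
    by_contra! h
    refine hne ?_
    have hz : ∀ σ, σ ≠ 1 → w σ = 0 := fun σ hσ => le_antisymm (h σ hσ) (hw0 σ)
    have h1 : w 1 = 1 := by
      rw [← hw1]
      exact (Finset.sum_eq_single 1 (fun σ _ hσ => hz σ hσ) (by simp)).symm
    rw [← hwE, Finset.sum_eq_single 1 (fun σ _ hσ => by rw [hz σ hσ, zero_smul]) (by simp), h1,
      one_smul, Matrix.permMatrix_one]
  have hle : ∀ σ τ : Equiv.Perm (Fin n),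
      ∑ p : Fin n × Fin n, A p.1 p.2 * B (τ p.1) (σ p.2) ≤ S := fun σ τ => by
    by_cases h : (τ, σ) = 1
    · obtain ⟨rfl, rfl⟩ : τ = 1 ∧ σ = 1 := by simpa using h
      rfl
    · exact (hAB τ σ h).le
  have hexp : matrixInner (A * E) (E * B) = ∑ σ, ∑ τ, w σ * w τ *
      ∑ p : Fin n × Fin n, A p.1 p.2 * B (τ p.1) (σ p.2) := by
    rw [← hwE, Matrix.mul_sum, Matrix.sum_mul]
    simp only [Matrix.mul_smul, Matrix.smul_mul]
    rw [matrixInner_sum_smul]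
    simp only [matrixInner_mul_permMatrix_permMatrix_mul]
  rw [hexp, hone]
  calc ∑ σ, ∑ τ, w σ * w τ * ∑ p : Fin n × Fin n, A p.1 p.2 * B (τ p.1) (σ p.2)
      < ∑ σ, ∑ τ, w σ * w τ * S := by
        refine Finset.sum_lt_sum (fun σ _ => Finset.sum_le_sum fun τ _ =>
          mul_le_mul_of_nonneg_left (hle σ τ) (mul_nonneg (hw0 _) (hw0 _)))
          ⟨σ, Finset.mem_univ _, Finset.sum_lt_sum (fun τ _ =>
            mul_le_mul_of_nonneg_left (hle σ τ) (mul_nonneg (hw0 _) (hw0 _)))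
            ⟨σ, Finset.mem_univ _, ?_⟩⟩
        exact mul_lt_mul_of_pos_left (hAB σ σ (by simpa using hσ1)) (mul_pos hσ hσ)
    _ = S := by
        simp only [← Finset.sum_mul, ← Finset.mul_sum, hw1, mul_one, one_mul]

theorem permMatrix_transpose_mul_mem_doublyStochastic (π : Equiv.Perm (Fin n))
    {D : Matrix (Fin n) (Fin n) ℝ} (hD : D ∈ doublyStochastic ℝ (Fin n)) :
    (π.permMatrix ℝ)ᵀ * D ∈ doublyStochastic ℝ (Fin n) := by
  rw [Matrix.transpose_permMatrix]
  exact mul_mem permMatrix_mem_doublyStochastic hD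

theorem permMatrix_transpose_mul_ne_one {π : Equiv.Perm (Fin n)} {D : Matrix (Fin n) (Fin n) ℝ}
    (hD : D ≠ π.permMatrix ℝ) : (π.permMatrix ℝ)ᵀ * D ≠ 1 := fun h => hD <| by
  rw [← Matrix.one_mul D, ← permMatrix_mul_transpose_self π, Matrix.mul_assoc, h, Matrix.mul_one]

theorem argminSet_neg_matrixInner_eq_singleton {A B : Matrix (Fin n) (Fin n) ℝ}
    (hAB : ∀ σ τ : Equiv.Perm (Fin n), (σ, τ) ≠ 1 →
      ∑ p : Fin n × Fin n, A p.1 p.2 * B (σ p.1) (τ p.2) <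
        ∑ p : Fin n × Fin n, A p.1 p.2 * B p.1 p.2) (π : Equiv.Perm (Fin n)) :
    argminSet (fun D => -matrixInner (π.permMatrix ℝ * A * (π.permMatrix ℝ)ᵀ * D) (D * B))
      (doublyStochasticMatrices n) = {π.permMatrix ℝ} := by
  set P := π.permMatrix ℝ with hP
  have hG : ∀ D, matrixInner (P * A * Pᵀ * D) (D * B) =
      matrixInner (A * (Pᵀ * D)) (Pᵀ * D * B) := fun D => by
    simp only [matrixInner, Matrix.transpose_mul, Matrix.transpose_transpose, Matrix.mul_assoc]
  refine argminSet_eq_singleton permMatrix_mem_doublyStochastic fun D hD hne => ?_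
  rw [hG, hG, transpose_permMatrix_mul_self]
  exact neg_lt_neg (matrixInner_mul_mul_lt_of_ne_one hAB
    (permMatrix_transpose_mul_mem_doublyStochastic π hD) (permMatrix_transpose_mul_ne_one hne))

/-- For orthogonal `Q` the squared norm is a constant minus twice the relaxed agreement at `Pᵀ * Q`.
-/
theorem argminSet_frobeniusNorm_eq_singleton {A B : Matrix (Fin n) (Fin n) ℝ}
    (hAB : ∀ σ τ : Equiv.Perm (Fin n), (σ, τ) ≠ 1 →
      ∑ p : Fin n × Fin n, A p.1 p.2 * B (σ p.1) (τ p.2) <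
        ∑ p : Fin n × Fin n, A p.1 p.2 * B p.1 p.2) (π : Equiv.Perm (Fin n)) :
    argminSet (fun Q => frobeniusNorm (π.permMatrix ℝ * A * (π.permMatrix ℝ)ᵀ - Q * B * Qᵀ))
      (permMatrices n) = {π.permMatrix ℝ} := by
  set P := π.permMatrix ℝ with hP
  have hexp : ∀ Q, Qᵀ * Q = 1 →
      matrixInner (P * A * Pᵀ - Q * B * Qᵀ) (P * A * Pᵀ - Q * B * Qᵀ) =
        matrixInner (P * A * Pᵀ) (P * A * Pᵀ) + matrixInner B B -
          2 * matrixInner (A * (Pᵀ * Q)) (Pᵀ * Q * B) := fun Q hQ => by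
    have h1 : matrixInner (P * A * Pᵀ) (Q * B * Qᵀ) =
        matrixInner (A * (Pᵀ * Q)) (Pᵀ * Q * B) := by
      simp only [matrixInner, Matrix.transpose_mul, Matrix.transpose_transpose]
      rw [← Matrix.mul_assoc, Matrix.trace_mul_comm]
      simp only [Matrix.mul_assoc]
    have h2 : matrixInner (Q * B * Qᵀ) (Q * B * Qᵀ) = matrixInner B B := by
      rw [Matrix.mul_assoc, matrixInner_mul_mul_of_transpose_mul_self hQ, matrixInner,
        Matrix.transpose_mul, Matrix.transpose_transpose, ← Matrix.mul_assoc,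
        Matrix.trace_mul_comm, ← Matrix.mul_assoc, ← Matrix.mul_assoc, hQ, Matrix.one_mul,
        matrixInner]
    rw [matrixInner_sub_left, matrixInner_sub_right, matrixInner_sub_right,
      matrixInner_comm (Q * B * Qᵀ) (P * A * Pᵀ), h1, h2]
    ring
  refine argminSet_eq_singleton ⟨π, rfl⟩ ?_
  rintro _ ⟨σ, rfl⟩ hne
  simp only [frobeniusNorm_eq_sqrt]
  refine Real.sqrt_lt_sqrt (matrixInner_self_nonneg _) ?_
  rw [hexp _ (transpose_permMatrix_mul_self π), hexp _ (transpose_permMatrix_mul_self σ),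
    transpose_permMatrix_mul_self]
  have := matrixInner_mul_mul_lt_of_ne_one hAB (permMatrix_transpose_mul_mem_doublyStochastic π
    (permMatrix_mem_doublyStochastic (σ := σ))) (permMatrix_transpose_mul_ne_one hne)
  linarith

/-! ### Deterministic failure of the convex relaxation -/

/-- Cauchy–Schwarz with the zero diagonal entry omitted; the factor `n - 1` instead of `n` yields
strict descent later. -/
theorem sum_row_sq_le {C : Matrix (Fin n) (Fin n) ℝ} (h0 : ∀ i, C i i = 0) :
    ∑ i, (∑ j, C i j) ^ 2 ≤ (n - 1) * matrixInner C C := by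
  rw [matrixInner_eq_sum, Finset.mul_sum]
  refine Finset.sum_le_sum fun i _ => ?_
  have h1 : ∀ f : Fin n → ℝ, f i = 0 → ∑ j, f j = ∑ j ∈ Finset.univ.erase i, f j := fun f hf => by
    rw [Finset.sum_erase _ hf]
  rw [h1 (fun j => C i j) (h0 i), h1 (fun j => C i j * C i j) (by simp [h0])]
  refine sq_sum_le_card_mul_sum_sq.trans (le_of_eq ?_)
  rw [Finset.card_erase_of_mem (Finset.mem_univ i), Finset.card_univ, Fintype.card_fin,
    Nat.cast_sub (Fin.pos i)]
  simp [sq]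

/-- The barycentre of the doubly stochastic matrices. -/
noncomputable def uniformMatrix (n : ℕ) : Matrix (Fin n) (Fin n) ℝ :=
  Matrix.of fun _ _ => (n : ℝ)⁻¹

theorem uniformMatrix_mem_doublyStochastic (hn : n ≠ 0) :
    uniformMatrix n ∈ doublyStochastic ℝ (Fin n) := by
  rw [mem_doublyStochastic_iff_sum]
  have : (n : ℝ) ≠ 0 := by exact_mod_cast hn
  simp [uniformMatrix, this]

theorem matrixInner_sub_commutator_uniformMatrix {A B : Matrix (Fin n) (Fin n) ℝ} (hA : A.IsSymm)
    (hB : B.IsSymm) :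
    matrixInner (A - B) (A * uniformMatrix n - uniformMatrix n * B) =
      (n : ℝ)⁻¹ * ∑ i, (∑ j, (A - B) i j) ^ 2 := by
  have hC : (A - B).IsSymm := hA.sub hB
  set C := A - B with hCdef
  have h1 : matrixInner C (A * uniformMatrix n) =
      (n : ℝ)⁻¹ * ∑ i, (∑ j, C i j) * ∑ k, A i k := by
    rw [matrixInner_eq_sum, Finset.mul_sum]
    refine Finset.sum_congr rfl fun i _ => ?_
    simp only [uniformMatrix, Matrix.mul_apply, Matrix.of_apply, ← Finset.sum_mul]
    ring
  have h2 : matrixInner C (uniformMatrix n * B) =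
      (n : ℝ)⁻¹ * ∑ i, (∑ j, C i j) * ∑ k, B i k := by
    rw [matrixInner_eq_sum, Finset.sum_comm, Finset.mul_sum]
    refine Finset.sum_congr rfl fun i _ => ?_
    simp only [uniformMatrix, Matrix.mul_apply, Matrix.of_apply, ← Finset.sum_mul,
      ← Finset.mul_sum, hC.apply, hB.apply]
    ring
  rw [matrixInner_sub_right, h1, h2, ← mul_sub, ← Finset.sum_sub_distrib]
  congr 1
  refine Finset.sum_congr rfl fun i _ => ?_
  rw [← mul_sub, ← Finset.sum_sub_distrib, sq]
  rfl

/-- Along the segment from `P` to the barycentre the squared norm is `‖C + t H‖²` with `⟨C, H⟩ ≤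
-⟨C, C⟩ / n < 0`. -/
theorem permMatrix_notMem_argminSet_frobeniusNorm {A B : Matrix (Fin n) (Fin n) ℝ}
    (hA : A.IsAdjMatrix) (hB : B.IsAdjMatrix) (hne : A ≠ B) (π : Equiv.Perm (Fin n)) :
    π.permMatrix ℝ ∉ argminSet
      (fun D => frobeniusNorm (π.permMatrix ℝ * A * (π.permMatrix ℝ)ᵀ * D - D * B))
      (doublyStochasticMatrices n) := by
  set P := π.permMatrix ℝ with hP
  have hn : n ≠ 0 := by
    rintro rfl
    exact hne (Subsingleton.elim _ _)
  have hn' : (0 : ℝ) < n := by exact_mod_cast Nat.pos_of_ne_zero hn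
  set C := A - B with hC
  set K := uniformMatrix n with hK
  set H := (A * K - K * B) - C with hH
  have hpos : 0 < matrixInner C C := matrixInner_self_pos (sub_ne_zero.2 hne)
  have hCH : matrixInner C H < 0 := by
    rw [hH, matrixInner_sub_right, hC, matrixInner_sub_commutator_uniformMatrix hA.symm hB.symm,
      ← hC]
    have h1 := sum_row_sq_le (C := C) fun i => by simp [hC, hA.apply_diag, hB.apply_diag]
    have h2 : (n : ℝ)⁻¹ * ∑ i, (∑ j, C i j) ^ 2 ≤ (n : ℝ)⁻¹ * ((n - 1) * matrixInner C C) := by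
      gcongr
    have h3 : (n : ℝ)⁻¹ * ((n - 1) * matrixInner C C) =
        matrixInner C C - (n : ℝ)⁻¹ * matrixInner C C := by
      field_simp
    have h4 : 0 < (n : ℝ)⁻¹ * matrixInner C C := by positivity
    linarith
  have hval : ∀ E, frobeniusNorm (P * A * Pᵀ * (P * E) - P * E * B) =
      √(matrixInner (A * E - E * B) (A * E - E * B)) := fun E => by
    have : P * A * Pᵀ * (P * E) - P * E * B = P * (A * E - E * B) := by
      rw [Matrix.mul_sub, Matrix.mul_assoc (P * A), ← Matrix.mul_assoc Pᵀ,
        transpose_permMatrix_mul_self, Matrix.one_mul, Matrix.mul_assoc, Matrix.mul_assoc]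
    rw [this, frobeniusNorm_eq_sqrt,
      matrixInner_mul_mul_of_transpose_mul_self (transpose_permMatrix_mul_self π)]
  rintro ⟨-, hmin⟩
  -- The cap `1` keeps `E` doubly stochastic; the quotient makes `2 t ⟨C, H⟩ + t² ⟨H, H⟩` negative,
  -- the `+ 1` guarding against `H = 0`.
  set t : ℝ := min 1 (-matrixInner C H / (matrixInner H H + 1)) with ht
  have hHH := matrixInner_self_nonneg H
  have ht0 : 0 < t := lt_min one_pos (div_pos (by linarith) (by linarith))
  have ht1 : t ≤ 1 := min_le_left _ _
  have ht2 : t * (matrixInner H H + 1) ≤ -matrixInner C H :=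
    (le_div_iff₀ (by linarith)).1 (min_le_right _ _)
  set E := (1 - t) • (1 : Matrix (Fin n) (Fin n) ℝ) + t • K with hE
  have hEmem : P * E ∈ doublyStochasticMatrices n :=
    mul_mem permMatrix_mem_doublyStochastic
      (convex_doublyStochastic (one_mem _) (uniformMatrix_mem_doublyStochastic hn)
        (by linarith) ht0.le (by ring))
  have hEC : A * E - E * B = C + t • H := by
    rw [hE, hH, hC]
    simp only [Matrix.mul_add, Matrix.add_mul, Matrix.mul_smul, Matrix.smul_mul, Matrix.mul_one,
      Matrix.one_mul]
    module
  have h1 : frobeniusNorm (P * A * Pᵀ * P - P * B) ≤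
      frobeniusNorm (P * A * Pᵀ * (P * E) - P * E * B) := hmin hEmem
  have h2 := hval 1
  rw [Matrix.mul_one, Matrix.mul_one, Matrix.one_mul] at h2
  rw [h2, hval, hEC, ← hC, Real.sqrt_le_sqrt_iff (matrixInner_self_nonneg _),
    matrixInner_add_left, matrixInner_add_right, matrixInner_add_right, matrixInner_smul_left,
    matrixInner_smul_left, matrixInner_smul_right, matrixInner_smul_right,
    matrixInner_comm H C] at h1
  nlinarith

end Deterministic

/-! ### Assembly -/

theorem theorem1 {Ω : Type*} [MeasurableSpace Ω] (μ : Measure Ω) [IsProbabilityMeasure μ]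
    (ρ α : ℝ) (hρ : ρ ∈ Set.Icc (0 : ℝ) 1) (hα : α ∈ Set.Ioo (0 : ℝ) (1 / 2))
    (Λ : ∀ n : ℕ, Matrix (Fin n) (Fin n) ℝ)
    (hΛ_symm : ∀ n, (Λ n).IsSymm) (hΛ_hollow : ∀ n i, Λ n i i = 0)
    (hΛ : ∀ n i j, i ≠ j → Λ n i j ∈ Set.Icc α (1 - α))
    (A B : ∀ n : ℕ, Ω → Matrix (Fin n) (Fin n) ℝ)
    (hAB : ∀ n, IsCorrelatedBernoulli μ ρ (Λ n) (A n) (B n))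
    (Pstar : ∀ n : ℕ, Matrix (Fin n) (Fin n) ℝ) (hP : ∀ n, Pstar n ∈ permMatrices n)
    (A' : ∀ n : ℕ, Ω → Matrix (Fin n) (Fin n) ℝ)
    (hA' : ∀ n ω, A' n ω = Pstar n * A n ω * (Pstar n)ᵀ) :
    ((1 - α) * (1 - ρ) < 1 / 2 →
      ∀ᵐ ω ∂μ, ∀ᶠ n in atTop,
        argminSet (fun D => -matrixInner (A' n ω * D) (D * B n ω)) (doublyStochasticMatrices n)
            = {Pstar n} ∧
        argminSet (fun P => frobeniusNorm (A' n ω - P * B n ω * Pᵀ)) (permMatrices n)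
            = {Pstar n}) ∧
    (ρ < 1 →
      ∀ᵐ ω ∂μ, ∀ᶠ n in atTop,
        Pstar n ∉
          argminSet (fun D => frobeniusNorm (A' n ω * D - D * B n ω))
            (doublyStochasticMatrices n)) := by
  obtain ⟨hρ0, hρ1⟩ := hρ
  obtain ⟨hα0, hα1⟩ := hα
  have hαα : 0 < α * (1 - α) := mul_pos hα0 (by linarith)
  choose π hπ using hP
  constructor
  · intro hαρ
    -- At `ρ = 0` the hypothesis would force `α > 1/2`.
    have hρpos : 0 < ρ := by
      by_contra h
      obtain rfl : ρ = 0 := le_antisymm (not_lt.1 h) hρ0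
      linarith
    have hκ : 0 < (ρ * (α * (1 - α))) ^ 2 / 128 := by positivity
    have hev := ae_eventually_notMem_of_summable_real (μ := μ)
      (summable_one_add_mul_exp_pow_sub_one hκ) (by
        filter_upwards [eventually_ge_atTop 4] with n hn
        exact (hAB n).measureReal_exists_perm_le hρ0 ⟨hα0.le, by linarith⟩ (hΛ_symm n)
          (hΛ_hollow n) (hΛ n) hn)
    filter_upwards [hev] with ω hω
    filter_upwards [hω] with n hn
    have hgap : ∀ σ τ : Equiv.Perm (Fin n), (σ, τ) ≠ 1 →
        ∑ p : Fin n × Fin n, A n ω p.1 p.2 * B n ω (σ p.1) (τ p.2) <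
          ∑ p : Fin n × Fin n, A n ω p.1 p.2 * B n ω p.1 p.2 := by
      intro σ τ hστ
      by_contra hle
      exact hn ⟨σ, τ, hστ, not_lt.1 hle⟩
    rw [hA', ← hπ n]
    exact ⟨argminSet_neg_matrixInner_eq_singleton hgap (π n),
      argminSet_frobeniusNorm_eq_singleton hgap (π n)⟩
  · intro hρ
    have hδ : 0 < 2 * (α * (1 - α)) * (1 - ρ) := by
      have := sub_pos.2 hρ
      positivity
    have hδ1 : 2 * (α * (1 - α)) * (1 - ρ) ≤ 1 := by
      have h1 : 2 * (α * (1 - α)) ≤ 1 := by nlinarith [sq_nonneg (1 - 2 * α)]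
      exact mul_le_one₀ h1 (by linarith) (by linarith)
    have hsum : Summable fun n : ℕ => (1 - 2 * (α * (1 - α)) * (1 - ρ)) ^ (n - 1) :=
      (summable_nat_add_iff 1).1 (by
        simpa using summable_geometric_of_lt_one (sub_nonneg.2 hδ1) (by linarith))
    have hev := ae_eventually_notMem_of_summable_real (μ := μ) hsum
      (Eventually.of_forall fun n => (hAB n).measureReal_eq_le hρ1 (hΛ n))
    filter_upwards [hev] with ω hω
    filter_upwards [hω] with n hn
    rw [hA', ← hπ n]
    exact permMatrix_notMem_argminSet_frobeniusNorm ((hAB n).isAdjMatrix_left ω)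
      ((hAB n).isAdjMatrix_right ω) hn (π n)
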